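/- Let $n\ge 1$ and let $q,s,t\in\mathbb C$ with $0<|q|,|s|,|t|<1$. For $\alpha\in\mathbb Z^n$ put $|\alpha|=|\alpha_1|+\dots+|\alpha_n|$, and let $\operatorname{sgn}(a)=1$ for $a\ge 0$ and $\operatorname{sgn}(a)=-1$ for $a<0$. Let $\pi_\alpha\in S_n$ be the permutation such that $\pi_\alpha(1),\dots,\pi_\alpha(n)$ lists the positions $1,\dots,n$ by decreasing $|\alpha_i|$, where among the positions with the same value of $|\alpha_i|$ those with $\alpha_i\ge 0$ come first, in increasing order, followed by those with $\alpha_i<0$, in decreasing order. Define the interpolation point $\overline\alpha\in(\mathbb C^*)^n$ (in the principal specialization) by $$\overline\alpha_i=q^{\alpha_i}\bigl(st^{\,n-\pi_\alpha^{-1}(i)}\bigr)^{\operatorname{sgn}(\alpha_i)}\qquad(1\le i\le n).$$ Let $\mathcal P_n=\mathbb C[x_1^{\pm1},\dots,x_n^{\pm1}]$; a Laurent polynomial has degree $\le d$ if only monomials $x^\gamma$ with $|\gamma|\le d$ occur in it. The nonsymmetric $BC$-type interpolation Macdonald polynomial $G_\alpha=G_\alpha(x;q,s,t)$ is the Laurent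 polynomial of degree $\le|\alpha|$ with $G_\alpha(\overline\alpha)=1$ and $G_\alpha(\overline\beta)=0$ for all $\beta\in\mathbb Z^n$ with $|\beta|\le|\alpha|$, $\beta\ne\alpha$. Let $s_j$ ($1\le j<n$) act on $\mathbb Z^n$ by interchanging the coordinates $j$ and $j+1$, let $s_n$ change the sign of the $n$-th coordinate, and let them act on $\mathcal P_n$ by $x^\gamma\mapsto x^{s_j\gamma}$. The Demazure–Lusztig operators on $\mathcal P_n$, with Hecke parameter $t$ at the long simple roots and $-1$ at the short simple root, are $$H_j^{(t)}=t+\frac{x_j-tx_{j+1}}{x_j-x_{j+1}}(s_j-1)\quad(1\le j<n),\qquad H_n^{(s)}=-1+\frac{(1-sx_n^{-1})(1-s^{-1}x_n^{-1})}{1-x_n^{-2}}(s_n-1).$$ Theorem. For every $\alpha\in\mathbb Z^n$ the Laurent polynomial $G_\alpha$ exists and is unique, and the following holds. (a) Let $1\le j<n$. If $s_j\alpha=\alpha$, then $H_j^{(t)}G_\alpha=tG_\alpha$. If $s_j\alpha\ne\alpha$, then $\overline\alpha_{j+1}\ne\overline\alpha_j$ and $$H_j^{(t)}G_\alpha=-G_\alpha+\frac{\overline\alpha_{j+1}-t\overline\alpha_j}{\overline\alpha_{j+1}-\overline\alpha_j}\bigl(G_{s_j\alpha}+G_\alpha\bigr).$$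 (b) One has $\overline\alpha_n^2\ne1$ and $$H_n^{(s)}G_\alpha=-G_\alpha+\frac{(1-s\overline\alpha_n)(1-s^{-1}\overline\alpha_n)}{1-\overline\alpha_n^2}\bigl(G_{s_n\alpha}+G_\alpha\bigr).$$ In particular, if $s_n\alpha=\alpha$, then $H_n^{(s)}G_\alpha=-G_\alpha$. -/

import Mathlib

open scoped BigOperators

namespace NonsymInterp

noncomputable section

/-! ### Combinatorics of `ℤⁿ` -/

/-- The weight `|α| = |α₁| + ⋯ + |αₙ|` of `α ∈ ℤⁿ`. -/
def weight {n : ℕ} (α : Fin n → ℤ) : ℕ := ∑ i, (α i).natAbs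

/-- The sign function with `sgn a = 1` for `a ≥ 0` and `sgn a = -1` for `a < 0`. -/
def sgn (a : ℤ) : ℤ := if 0 ≤ a then 1 else -1

/-- The sorting key of the position `i` of `α`: entries are listed by decreasing absolute value;
among the entries with a common absolute value, the nonnegative ones come first, by increasing
position, followed by the negative ones, by decreasing position. -/
def sortKey {n : ℕ} (α : Fin n → ℤ) (i : Fin n) : ℤ ×ₗ ℤ :=
  toLex (-|α i|, if 0 ≤ α i then (i : ℤ) else 2 * (n : ℤ) - (i : ℤ))

/-- The permutation `π_α`: `sortPerm α k` is the position listed as number `k` in the order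
described in `sortKey`. It is the permutation part of the shortest element `w_α = σ_α π_α` of the
hyperoctahedral group which sends the partition `α⁺` in the orbit of `α` to `α`. -/
def sortPerm {n : ℕ} (α : Fin n → ℤ) : Equiv.Perm (Fin n) := Tuple.sort (sortKey α)

/-- The principal specialization `τᵢ = s t^(n-i)` for `i = 1, …, n`.
The index `i : Fin n` is counted from `0`, so that it stands for the number `i + 1`. -/
def principalPoint {n : ℕ} (s t : ℂ) (i : Fin n) : ℂ := s * t ^ (n - ((i : ℕ) + 1))

/-- The interpolation point `ᾱ(q, τ)`, with coordinates `ᾱᵢ = q^αᵢ (τ_{π_α⁻¹(i)})^sgn(αᵢ)`. -/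
def interpPoint {n : ℕ} (q : ℂ) (τ : Fin n → ℂ) (α : Fin n → ℤ) (i : Fin n) : ℂ :=
  q ^ (α i) * (τ ((sortPerm α).symm i)) ^ (sgn (α i))

/-! ### Laurent polynomials -/

/-- The algebra `ℂ[x₁^±1, …, xₙ^±1]` of Laurent polynomials, as the group algebra of `ℤⁿ`. -/
abbrev LaurentPoly (n : ℕ) : Type := AddMonoidAlgebra ℂ (Fin n → ℤ)

/-- The Laurent monomial `x^γ`. -/
def mono {n : ℕ} (γ : Fin n → ℤ) : LaurentPoly n := AddMonoidAlgebra.single γ 1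

/-- The variable `xᵢ`. -/
def X {n : ℕ} (i : Fin n) : LaurentPoly n := mono (Pi.single i 1)

/-- The inverse variable `xᵢ⁻¹`. -/
def Xinv {n : ℕ} (i : Fin n) : LaurentPoly n := mono (Pi.single i (-1))

/-- The value of a Laurent polynomial at a point with nonzero coordinates. -/
def evalAt {n : ℕ} (x : Fin n → ℂ) (f : LaurentPoly n) : ℂ :=
  f.coeff.sum fun γ c => c * ∏ i, x i ^ γ i

/-- The Laurent polynomial `f` has degree at most `d`: only monomials of weight at most `d`
occur in it. -/
def DegLE {n : ℕ} (d : ℕ) (f : LaurentPoly n) : Prop :=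
  ∀ γ : Fin n → ℤ, f.coeff γ ≠ 0 → weight γ ≤ d

/-! ### Interpolation polynomials -/

/-- `f` solves the interpolation problem of degree `α`: it has degree at most `|α|`, takes the
value `1` at `ᾱ`, and vanishes at `β̄` for all `β ≠ α` with `|β| ≤ |α|`. -/
def IsInterp {n : ℕ} (q : ℂ) (τ : Fin n → ℂ) (α : Fin n → ℤ) (f : LaurentPoly n) : Prop :=
  DegLE (weight α) f ∧
  evalAt (interpPoint q τ α) f = 1 ∧
  ∀ β : Fin n → ℤ, weight β ≤ weight α → β ≠ α → evalAt (interpPoint q τ β) f = 0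

/-- The nonsymmetric interpolation Laurent polynomial `G_α(x; q, s, t)` in the principal
specialization: the solution of the interpolation problem of degree `α` with `τᵢ = s t^(n-i)`. -/
def G {n : ℕ} (q s t : ℂ) (α : Fin n → ℤ) : LaurentPoly n :=
  Classical.epsilon (IsInterp q (principalPoint s t) α)

/-! ### Simple reflections -/

/-- The reflection of `ℤⁿ` which interchanges the coordinates `i` and `j`. -/
def swapRefl {n : ℕ} (i j : Fin n) : (Fin n → ℤ) →+ (Fin n → ℤ) where
  toFun α := fun k => α (Equiv.swap i j k)
  map_zero' := rfl
  map_add' _ _ := rfl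

/-- The reflection of `ℤⁿ` which changes the sign of the coordinate `i`. -/
def signRefl {n : ℕ} (i : Fin n) : (Fin n → ℤ) →+ (Fin n → ℤ) where
  toFun α := fun k => if k = i then -α k else α k
  map_zero' := by ext k; simp
  map_add' α β := by
    ext k
    by_cases h : k = i
    · simp [h]; ring
    · simp [h]

/-- The simple reflections `s₁, …, s_m` of type `B_{m+1}` other than the last one. -/
def simpleRefl {m : ℕ} (j : Fin m) : (Fin (m + 1) → ℤ) →+ (Fin (m + 1) → ℤ) :=
  swapRefl j.castSucc j.succ

/-- The last simple reflection of type `B_{m+1}`, that of the short simple root. -/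
def lastRefl (m : ℕ) : (Fin (m + 1) → ℤ) →+ (Fin (m + 1) → ℤ) := signRefl (Fin.last m)

/-- The action `x^γ ↦ x^(wγ)` on Laurent polynomials of an additive map `w` of `ℤⁿ`. -/
def act {n : ℕ} (w : (Fin n → ℤ) →+ (Fin n → ℤ)) : LaurentPoly n →ₐ[ℂ] LaurentPoly n :=
  AddMonoidAlgebra.mapDomainAlgHom ℂ ℂ w

/-! ### Divided differences -/

lemma mono_add {n : ℕ} (γ δ : Fin n → ℤ) : mono (γ + δ) = mono γ * mono δ := by
  simp [mono, AddMonoidAlgebra.single_mul_single]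

lemma mono_zero {n : ℕ} : mono (0 : Fin n → ℤ) = 1 := rfl

lemma mono_injective {n : ℕ} : Function.Injective (mono (n := n)) := by
  intro γ δ h
  exact AddMonoidAlgebra.single_left_injective one_ne_zero h

lemma act_mono {n : ℕ} (w : (Fin n → ℤ) →+ (Fin n → ℤ)) (γ : Fin n → ℤ) :
    act w (mono γ) = mono (w γ) := by
  simp [act, mono]

lemma X_sub_X_ne_zero {m : ℕ} (j : Fin m) :
    (X j.castSucc - X j.succ : LaurentPoly (m + 1)) ≠ 0 := by
  intro h
  have h1 := congrFun (mono_injective (sub_eq_zero.mp h)) j.castSucc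
  rw [Pi.single_eq_same, Pi.single_eq_of_ne (Fin.castSucc_lt_succ).ne] at h1
  exact one_ne_zero h1

lemma one_sub_Xinv_sq_ne_zero {n : ℕ} (i : Fin n) :
    (1 - Xinv i ^ 2 : LaurentPoly n) ≠ 0 := by
  intro h
  rw [← mono_zero, pow_two, Xinv, ← mono_add] at h
  have h1 := congrFun (mono_injective (sub_eq_zero.mp h)) i
  simp at h1

lemma dvd_mono_sub {n : ℕ} (w : (Fin n → ℤ) →+ (Fin n → ℤ)) (b : LaurentPoly n)
    (h : ∀ k, b ∣ act w (X k) - X k) (γ : Fin n → ℤ) : b ∣ mono (w γ) - mono γ := by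
  let S : AddSubgroup (Fin n → ℤ) :=
    { carrier := {γ | b ∣ mono (w γ) - mono γ}
      zero_mem' := by simp
      add_mem' := by
        intro γ δ hγ hδ
        have e : mono (w (γ + δ)) - mono (γ + δ) =
            mono (w γ) * (mono (w δ) - mono δ) + (mono (w γ) - mono γ) * mono δ := by
          rw [map_add, mono_add, mono_add]; ring
        simp only [Set.mem_ofPred_eq] at hγ hδ ⊢
        rw [e]
        exact dvd_add (hδ.mul_left _) (hγ.mul_right _)
      neg_mem' := by
        intro γ hγ
        have e1 : mono (w γ) * mono (-w γ) = 1 := by rw [← mono_add, add_neg_cancel, mono_zero]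
        have e2 : mono γ * mono (-γ) = 1 := by rw [← mono_add, add_neg_cancel, mono_zero]
        have e : mono (w (-γ)) - mono (-γ) =
            (mono (w γ) - mono γ) * (-(mono (-w γ) * mono (-γ))) := by
          rw [map_neg]
          linear_combination mono (-γ) * e1 - mono (-w γ) * e2
        simp only [Set.mem_ofPred_eq] at hγ ⊢
        rw [e]
        exact hγ.mul_right _ }
  have hS : ∀ k, Pi.single k 1 ∈ S := by
    intro k
    have := h k
    rw [X, act_mono] at this
    exact this
  have hγ : γ = ∑ k, γ k • (Pi.single k 1 : Fin n → ℤ) := by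
    ext i
    simp [Finset.sum_apply, Pi.single_apply]
  have : γ ∈ S := by
    rw [hγ]
    exact S.sum_mem fun k _ => S.zsmul_mem (hS k) _
  exact this

/-- If an additive map `w` moves every variable only by a multiple of `b`, then it moves every
Laurent polynomial only by a multiple of `b`. -/
lemma dvd_act_sub {n : ℕ} (w : (Fin n → ℤ) →+ (Fin n → ℤ)) (b : LaurentPoly n)
    (h : ∀ k, b ∣ act w (X k) - X k) (f : LaurentPoly n) : b ∣ act w f - f := by
  induction f using AddMonoidAlgebra.induction_linear with
  | zero => simp
  | add f g hf hg =>
    rw [map_add, add_sub_add_comm]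
    exact dvd_add hf hg
  | single γ c =>
    have e : (AddMonoidAlgebra.single γ c : LaurentPoly n) = c • mono γ := by
      simp [mono]
    rw [e, map_smul, act_mono, ← smul_sub]
    obtain ⟨g, hg⟩ := dvd_mono_sub w b h γ
    exact ⟨c • g, by rw [hg, mul_smul_comm]⟩

lemma dvd_simpleRefl {m : ℕ} (j : Fin m) (f : LaurentPoly (m + 1)) :
    (X j.castSucc - X j.succ) ∣ act (simpleRefl j) f - f := by
  apply dvd_act_sub
  intro k
  have e : simpleRefl j (Pi.single k 1) =
      Pi.single (Equiv.swap j.castSucc j.succ k) 1 := by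
    ext i
    simp only [simpleRefl, swapRefl, AddMonoidHom.coe_mk, ZeroHom.coe_mk, Pi.single_apply]
    refine if_congr ?_ rfl rfl
    rw [Equiv.swap_apply_eq_iff]
  have e' : act (simpleRefl j) (X k) = X (Equiv.swap j.castSucc j.succ k) := by
    rw [X, act_mono, e, X]
  rw [e']
  by_cases h1 : k = j.castSucc
  · subst h1
    rw [Equiv.swap_apply_left]
    exact ⟨-1, by ring⟩
  · by_cases h2 : k = j.succ
    · subst h2
      rw [Equiv.swap_apply_right]
    · rw [Equiv.swap_apply_of_ne_of_ne h1 h2, sub_self]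
      exact dvd_zero _

lemma dvd_lastRefl {m : ℕ} (f : LaurentPoly (m + 1)) :
    (1 - Xinv (Fin.last m) ^ 2) ∣ act (lastRefl m) f - f := by
  apply dvd_act_sub
  intro k
  by_cases h : k = Fin.last m
  · subst h
    have e : lastRefl m (Pi.single (Fin.last m) 1) = Pi.single (Fin.last m) (-1) := by
      ext i
      by_cases hi : i = Fin.last m
      · subst hi; simp [lastRefl, signRefl]
      · simp [lastRefl, signRefl, hi]
    have e2 : X (Fin.last m) * Xinv (Fin.last m) = 1 := by
      rw [X, Xinv, ← mono_add, ← Pi.single_add, add_neg_cancel, Pi.single_zero, mono_zero]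
    refine ⟨-X (Fin.last m), ?_⟩
    rw [X, act_mono, e]
    change Xinv (Fin.last m) - X (Fin.last m) = _ * (-X (Fin.last m))
    linear_combination -Xinv (Fin.last m) * e2
  · have e : lastRefl m (Pi.single k 1) = Pi.single k 1 := by
      ext i
      by_cases hi : i = Fin.last m
      · subst hi; simp [lastRefl, signRefl, Ne.symm h]
      · simp [lastRefl, signRefl, hi]
    rw [X, act_mono, e, sub_self]
    exact dvd_zero _

/-- The divided difference `f ↦ (w f - f) / b`, where `b ≠ 0` divides `w f - f` for every Laurent
polynomial `f`: its value at `f` is the Laurent polynomial `g` with `w f - f = b g`. -/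
def dividedDiff {n : ℕ} (w : (Fin n → ℤ) →+ (Fin n → ℤ)) (b : LaurentPoly n) (hb : b ≠ 0)
    (h : ∀ f, b ∣ act w f - f) : LaurentPoly n →ₗ[ℂ] LaurentPoly n where
  toFun f := (h f).choose
  map_add' f g := by
    apply mul_left_cancel₀ hb
    rw [mul_add, ← (h (f + g)).choose_spec, ← (h f).choose_spec, ← (h g).choose_spec, map_add]
    ring
  map_smul' c f := by
    apply mul_left_cancel₀ hb
    rw [RingHom.id_apply, mul_smul_comm, ← (h (c • f)).choose_spec, ← (h f).choose_spec,
      map_smul, smul_sub]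

lemma mul_dividedDiff {n : ℕ} (w : (Fin n → ℤ) →+ (Fin n → ℤ)) (b : LaurentPoly n) (hb : b ≠ 0)
    (h : ∀ f, b ∣ act w f - f) (f : LaurentPoly n) :
    b * dividedDiff w b hb h f = act w f - f :=
  (h f).choose_spec.symm

/-! ### Demazure–Lusztig operators -/

/-- The Demazure–Lusztig operator
`H_j^(t) = t + (x_j - t x_{j+1}) / (x_j - x_{j+1}) * (s_j - 1)` for `j` other than the last node,
in `m + 1` variables. -/
def demazureLusztig {m : ℕ} (t : ℂ) (j : Fin m) :
    LaurentPoly (m + 1) →ₗ[ℂ] LaurentPoly (m + 1) :=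
  t • LinearMap.id +
    LinearMap.mulLeft ℂ (X j.castSucc - t • X j.succ) ∘ₗ
      dividedDiff (simpleRefl j) (X j.castSucc - X j.succ) (X_sub_X_ne_zero j) (dvd_simpleRefl j)

/-- The Demazure–Lusztig operator
`H_n^(s) = -1 + (1 - s x_n⁻¹) (1 - s⁻¹ x_n⁻¹) / (1 - x_n⁻²) * (s_n - 1)` for the last node,
in `n = m + 1` variables, with Hecke parameter `-1`. -/
def demazureLusztigLast (m : ℕ) (s : ℂ) :
    LaurentPoly (m + 1) →ₗ[ℂ] LaurentPoly (m + 1) :=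
  -LinearMap.id +
    LinearMap.mulLeft ℂ
        ((1 - s • Xinv (Fin.last m)) * (1 - s⁻¹ • Xinv (Fin.last m))) ∘ₗ
      dividedDiff (lastRefl m) (1 - Xinv (Fin.last m) ^ 2)
        (one_sub_Xinv_sq_ne_zero (Fin.last m)) dvd_lastRefl

end

end NonsymInterp

open NonsymInterp

/-!
The conditions on `q`, `s`, `t` keep the coordinates of an interpolation point apart from each other
and from each other's inverses. Interpolation at the points `γ̄` with `|γ| ≤ d` by Laurent
polynomials of degree at most `d` is then uniquely solvable: for every `α` there is a product of
linear factors of degree at most `|α|` (a Newton polynomial), and the matrix of the values of these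
products at the interpolation points is triangular with nonzero diagonal entries, for the
colexicographic order on the sets of sorting keys.

The Demazure–Lusztig operators preserve the filtration by degree because the weight is convex and
invariant under the reflections. Each of them has the form `T = κ + c (w - 1)` with a simple
reflection `w` and a rational function `c`. If `w β ≠ β`, then the value of `w f` at `β̄` is the
value of `f` at the interpolation point of `w β`; if `w β = β`, then `c` vanishes at `β̄`, a
property of the principal specialization. Hence the values of `T f` at interpolation points depend
only on those of `f`. Those of `T G_α` vanish outside `{α, w α}`, so `T G_α` is an explicit
combination of `G_α` and `G_{w α}`.
-/

namespace NonsymInterp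

noncomputable section

/-! ### Laurent polynomials -/

section LaurentPoly

variable {n : ℕ}

/-- Evaluation of Laurent polynomials at a point with nonzero coordinates, as an algebra
homomorphism. -/
def evalHom (x : Fin n → ℂ) (hx : ∀ i, x i ≠ 0) : LaurentPoly n →ₐ[ℂ] ℂ :=
  AddMonoidAlgebra.lift ℂ ℂ (Fin n → ℤ)
    { toFun := fun γ => ∏ i, x i ^ γ.toAdd i
      map_one' := by simp
      map_mul' := fun γ δ => by
        simp only [toAdd_mul, Pi.add_apply, zpow_add₀ (hx _), Finset.prod_mul_distrib] }

lemma evalHom_apply (x : Fin n → ℂ) (hx : ∀ i, x i ≠ 0) (f : LaurentPoly n) :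
    evalHom x hx f = evalAt x f := by
  rw [evalHom, AddMonoidAlgebra.lift_apply]
  rfl

lemma evalHom_mono (x : Fin n → ℂ) (hx : ∀ i, x i ≠ 0) (γ : Fin n → ℤ) :
    evalHom x hx (mono γ) = ∏ i, x i ^ γ i := by
  simp [evalHom, mono]

lemma evalHom_mono_single (x : Fin n → ℂ) (hx : ∀ i, x i ≠ 0) (i : Fin n) (z : ℤ) :
    evalHom x hx (mono (Pi.single i z)) = x i ^ z := by
  rw [evalHom_mono, Finset.prod_eq_single_of_mem i (Finset.mem_univ i), Pi.single_eq_same]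
  intro j _ hj
  rw [Pi.single_eq_of_ne hj, zpow_zero]

lemma evalHom_X (x : Fin n → ℂ) (hx : ∀ i, x i ≠ 0) (i : Fin n) : evalHom x hx (X i) = x i := by
  rw [X, evalHom_mono_single, zpow_one]

lemma evalHom_Xinv (x : Fin n → ℂ) (hx : ∀ i, x i ≠ 0) (i : Fin n) :
    evalHom x hx (Xinv i) = (x i)⁻¹ := by
  rw [Xinv, evalHom_mono_single, zpow_neg_one]

lemma evalHom_act (w : (Fin n → ℤ) →+ (Fin n → ℤ)) {x y : Fin n → ℂ} (hx : ∀ i, x i ≠ 0)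
    (hy : ∀ i, y i ≠ 0) (h : ∀ γ, ∏ i, x i ^ w γ i = ∏ i, y i ^ γ i) (f : LaurentPoly n) :
    evalHom x hx (act w f) = evalHom y hy f := by
  suffices (evalHom x hx).comp (act w) = evalHom y hy from DFunLike.congr_fun this f
  refine AddMonoidAlgebra.algHom_ext (fun γ => ?_) (Subsingleton.elim _ _)
  change evalHom x hx (act w (mono γ)) = evalHom y hy (mono γ)
  rw [act_mono, evalHom_mono, evalHom_mono, h]

lemma Xinv_pow (i : Fin n) (k : ℕ) : Xinv i ^ k = mono (Pi.single i (-k : ℤ)) := by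
  rw [Xinv, mono, mono, AddMonoidAlgebra.single_pow, one_pow, ← Pi.single_smul, nsmul_eq_mul,
    mul_neg_one]

open scoped Pointwise in
lemma mul_mem_supported_Icc {l u l' u' : Fin n → ℤ} {f g : LaurentPoly n}
    (hf : f ∈ AddMonoidAlgebra.supported ℂ ℂ (Set.Icc l u))
    (hg : g ∈ AddMonoidAlgebra.supported ℂ ℂ (Set.Icc l' u')) :
    f * g ∈ AddMonoidAlgebra.supported ℂ ℂ (Set.Icc (l + l') (u + u')) := by
  classical
  rw [AddMonoidAlgebra.mem_supported] at hf hg ⊢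
  calc ((f * g).coeff.support : Set (Fin n → ℤ))
      ⊆ f.coeff.support + g.coeff.support := by
        exact_mod_cast AddMonoidAlgebra.support_coeff_mul_subset f g
    _ ⊆ Set.Icc l u + Set.Icc l' u' := Set.add_subset_add hf hg
    _ ⊆ Set.Icc (l + l') (u + u') := Set.Icc_add_Icc_subset l u l' u'

lemma prod_mem_supported_Icc {ι : Type*} {s : Finset ι} {f : ι → LaurentPoly n}
    {l u : ι → Fin n → ℤ}
    (h : ∀ a ∈ s, f a ∈ AddMonoidAlgebra.supported ℂ ℂ (Set.Icc (l a) (u a))) :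
    ∏ a ∈ s, f a ∈ AddMonoidAlgebra.supported ℂ ℂ (Set.Icc (∑ a ∈ s, l a) (∑ a ∈ s, u a)) := by
  classical
  induction s using Finset.induction_on with
  | empty =>
    rw [Finset.prod_empty, AddMonoidAlgebra.mem_supported]
    simp
  | insert a s ha ih =>
    rw [Finset.prod_insert ha, Finset.sum_insert ha, Finset.sum_insert ha]
    exact mul_mem_supported_Icc (h a (Finset.mem_insert_self a s))
      (ih fun b hb => h b (Finset.mem_insert_of_mem hb))

/-- The Laurent polynomials of degree at most `d`. -/
def degSubmodule (n d : ℕ) : Submodule ℂ (LaurentPoly n) :=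
  AddMonoidAlgebra.supported ℂ ℂ {γ | weight γ ≤ d}

lemma mem_degSubmodule {d : ℕ} {f : LaurentPoly n} : f ∈ degSubmodule n d ↔ DegLE d f := by
  simp only [degSubmodule, AddMonoidAlgebra.mem_supported, Set.subset_def, Finset.mem_coe,
    Finsupp.mem_support_iff, Set.mem_ofPred_eq, DegLE]

lemma degSubmodule_eq_span (n d : ℕ) :
    degSubmodule n d = Submodule.span ℂ (mono '' {γ | weight γ ≤ d}) :=
  AddMonoidAlgebra.supported_eq_span_single ℂ _

lemma mono_mem_degSubmodule {d : ℕ} {γ : Fin n → ℤ} (h : weight γ ≤ d) :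
    mono γ ∈ degSubmodule n d := by
  rw [degSubmodule_eq_span]
  exact Submodule.subset_span ⟨γ, h, rfl⟩

lemma degSubmodule_mono {d e : ℕ} (h : d ≤ e) : degSubmodule n d ≤ degSubmodule n e :=
  AddMonoidAlgebra.supported_mono fun _ hγ => le_trans hγ h

lemma map_mem_degSubmodule {d : ℕ} {T : LaurentPoly n →ₗ[ℂ] LaurentPoly n}
    (hT : ∀ γ, weight γ ≤ d → T (mono γ) ∈ degSubmodule n d) {f : LaurentPoly n}
    (hf : f ∈ degSubmodule n d) : T f ∈ degSubmodule n d := by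
  suffices degSubmodule n d ≤ (degSubmodule n d).comap T from this hf
  rw [degSubmodule_eq_span n d, Submodule.span_le, ← degSubmodule_eq_span]
  rintro _ ⟨γ, hγ, rfl⟩
  exact hT γ hγ

lemma finite_setOf_weight_le (n d : ℕ) : {γ : Fin n → ℤ | weight γ ≤ d}.Finite := by
  refine (Set.finite_Icc (fun _ => -(d : ℤ)) (fun _ => (d : ℤ))).subset fun γ hγ => ?_
  have h i : (γ i).natAbs ≤ d :=
    (Finset.single_le_sum_of_canonicallyOrdered (f := fun i => (γ i).natAbs)
      (Finset.mem_univ i)).trans hγ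
  constructor <;> intro i <;> have := h i <;> dsimp only <;> omega

end LaurentPoly

/-! ### The order of the positions -/

section Order

variable {n : ℕ} {γ δ : Fin n → ℤ} {i j : Fin n}

lemma sortKey_lt_sortKey_iff : sortKey γ i < sortKey δ j ↔
    (δ j).natAbs < (γ i).natAbs ∨ (γ i).natAbs = (δ j).natAbs ∧
      (0 ≤ γ i ∧ δ j < 0 ∨ 0 ≤ γ i ∧ 0 ≤ δ j ∧ (i : ℕ) < j ∨
        γ i < 0 ∧ δ j < 0 ∧ (j : ℕ) < i) := by
  rw [sortKey, sortKey, Prod.Lex.toLex_lt_toLex, Int.abs_eq_natAbs, Int.abs_eq_natAbs]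
  dsimp only
  split_ifs <;> omega

lemma sortKey_eq_sortKey_iff : sortKey γ i = sortKey δ j ↔ i = j ∧ γ i = δ j := by
  rw [sortKey, sortKey, toLex_inj, Prod.mk.injEq, Fin.ext_iff, Int.abs_eq_natAbs,
    Int.abs_eq_natAbs]
  split_ifs <;> omega

lemma sortKey_congr (h : γ i = δ i) : sortKey γ i = sortKey δ i :=
  sortKey_eq_sortKey_iff.mpr ⟨rfl, h⟩

lemma sortKey_injective (γ : Fin n → ℤ) : Function.Injective (sortKey γ) :=
  fun _ _ h => (sortKey_eq_sortKey_iff.mp h).1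

lemma sortPerm_symm_lt_iff :
    (sortPerm γ).symm i < (sortPerm γ).symm j ↔ sortKey γ i < sortKey γ j := by
  have hm : StrictMono (sortKey γ ∘ sortPerm γ) :=
    (Tuple.monotone_sort (sortKey γ)).strictMono_of_injective
      ((sortKey_injective γ).comp (sortPerm γ).injective)
  rw [← hm.lt_iff_lt, Function.comp_apply, Function.comp_apply, Equiv.apply_symm_apply,
    Equiv.apply_symm_apply]

/-- The number of positions which are listed after the position `i` by `sortPerm γ`. Being the
size of a set of positions, it can be compared between different `γ`. -/
def corank (γ : Fin n → ℤ) (i : Fin n) : ℕ :=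
  (Finset.univ.filter fun l => sortKey γ i < sortKey γ l).card

lemma corank_eq (γ : Fin n → ℤ) (i : Fin n) :
    corank γ i = n - (((sortPerm γ).symm i : ℕ) + 1) := by
  rw [← Fin.val_rev, Fin.val_rev, ← Nat.sub_sub, Nat.sub_right_comm, ← Fin.card_Ioi]
  refine Finset.card_equiv (sortPerm γ).symm fun l => ?_
  simp only [Finset.mem_filter, Finset.mem_univ, true_and, Finset.mem_Ioi, sortPerm_symm_lt_iff]

lemma sortPerm_symm_le_iff_corank_le :
    (sortPerm γ).symm i ≤ (sortPerm δ).symm j ↔ corank δ j ≤ corank γ i := by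
  rw [corank_eq, corank_eq, Fin.le_def]
  omega

lemma corank_congr (e : Equiv.Perm (Fin n)) (h : ∀ l, sortKey γ i < sortKey γ l ↔
    sortKey δ (e i) < sortKey δ (e l)) : corank γ i = corank δ (e i) := by
  refine Finset.card_equiv e fun l => ?_
  simp only [Finset.mem_filter, Finset.mem_univ, true_and, h l]

lemma corank_eq_succ (h : ∀ l, sortKey γ i < sortKey γ l ↔ l = j ∨ sortKey γ j < sortKey γ l) :
    corank γ i = corank γ j + 1 := by
  rw [corank, corank, ← Finset.card_insert_of_notMem (a := j) (by simp)]
  congr 1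
  ext l
  simp only [Finset.mem_filter, Finset.mem_univ, true_and, Finset.mem_insert, h l]

end Order

/-! ### Interpolation points -/

section InterpPoint

variable {n : ℕ} {q : ℂ} {τ : Fin n → ℂ} {γ δ : Fin n → ℤ} {i j : Fin n}

/-- The conditions on the parameters `q` and `τ₁, …, τₙ` which separate the coordinates of the
interpolation points from each other and from each other's inverses. -/
structure IsGeneric (q : ℂ) (τ : Fin n → ℂ) : Prop where
  q_ne_zero : q ≠ 0
  ne_zero : ∀ i, τ i ≠ 0
  mul_ne_one : ∀ (a : ℕ) i j, q ^ a * (τ i * τ j) ≠ 1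
  eq_of_mul_eq : ∀ (a : ℕ) i j, i ≤ j → q ^ a * τ i = τ j → a = 0 ∧ i = j

lemma sgn_of_nonneg {a : ℤ} (h : 0 ≤ a) : sgn a = 1 := if_pos h

lemma sgn_of_neg {a : ℤ} (h : a < 0) : sgn a = -1 := if_neg h.not_ge

lemma zpow_sgn_eq_one_iff {x : ℂ} {a : ℤ} : x ^ sgn a = 1 ↔ x = 1 := by
  rcases le_or_gt 0 a with h | h
  · rw [sgn_of_nonneg h, zpow_one]
  · rw [sgn_of_neg h, zpow_neg_one, inv_eq_one]

lemma interpPoint_eq_zpow_sgn (q : ℂ) (τ : Fin n → ℂ) (γ : Fin n → ℤ) (i : Fin n) :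
    interpPoint q τ γ i = (q ^ (γ i).natAbs * τ ((sortPerm γ).symm i)) ^ sgn (γ i) := by
  rw [interpPoint, mul_zpow, ← zpow_natCast, ← zpow_mul]
  congr 2
  rcases le_or_gt 0 (γ i) with h | h
  · rw [sgn_of_nonneg h]; omega
  · rw [sgn_of_neg h]; omega

lemma interpPoint_congr (h : γ i = δ j) (hc : corank γ i = corank δ j) :
    interpPoint q τ γ i = interpPoint q τ δ j := by
  have hπ : (sortPerm γ).symm i = (sortPerm δ).symm j :=
    le_antisymm (sortPerm_symm_le_iff_corank_le.mpr hc.ge)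
      (sortPerm_symm_le_iff_corank_le.mpr hc.le)
  rw [interpPoint, interpPoint, h, hπ]

lemma IsGeneric.interpPoint_ne_zero (h : IsGeneric q τ) (γ : Fin n → ℤ) (i : Fin n) :
    interpPoint q τ γ i ≠ 0 :=
  mul_ne_zero (zpow_ne_zero _ h.q_ne_zero) (zpow_ne_zero _ (h.ne_zero _))

lemma IsGeneric.eq_of_interpPoint_eq (h : IsGeneric q τ) (hle : (δ j).natAbs ≤ (γ i).natAbs)
    (hc : corank δ j ≤ corank γ i) (he : interpPoint q τ γ i = interpPoint q τ δ j) :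
    γ i = δ j ∧ (sortPerm γ).symm i = (sortPerm δ).symm j := by
  rw [interpPoint_eq_zpow_sgn, interpPoint_eq_zpow_sgn] at he
  rw [← sortPerm_symm_le_iff_corank_le] at hc
  set k := (sortPerm γ).symm i
  set l := (sortPerm δ).symm j
  have hτ : τ k * τ l ≠ 0 := mul_ne_zero (h.ne_zero k) (h.ne_zero l)
  have same_sign : q ^ (γ i).natAbs * τ k = q ^ (δ j).natAbs * τ l →
      (γ i).natAbs = (δ j).natAbs ∧ k = l := by
    intro he
    have hsplit : (γ i).natAbs = (δ j).natAbs + ((γ i).natAbs - (δ j).natAbs) := by omega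
    rw [hsplit, pow_add, mul_assoc] at he
    have := h.eq_of_mul_eq _ k l hc (mul_left_cancel₀ (pow_ne_zero _ h.q_ne_zero) he)
    exact ⟨by omega, this.2⟩
  have opposite_sign : q ^ (γ i).natAbs * τ k ≠ (q ^ (δ j).natAbs * τ l)⁻¹ := by
    intro he
    refine h.mul_ne_one ((γ i).natAbs + (δ j).natAbs) k l ?_
    rw [pow_add, mul_mul_mul_comm, he, inv_mul_cancel₀]
    exact mul_ne_zero (pow_ne_zero _ h.q_ne_zero) (h.ne_zero l)
  rcases le_or_gt 0 (γ i) with hi | hi <;> rcases le_or_gt 0 (δ j) with hj | hj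
  · rw [sgn_of_nonneg hi, sgn_of_nonneg hj, zpow_one, zpow_one] at he
    exact ⟨by have := same_sign he; omega, (same_sign he).2⟩
  · rw [sgn_of_nonneg hi, sgn_of_neg hj, zpow_one, zpow_neg_one] at he
    exact absurd he opposite_sign
  · rw [sgn_of_neg hi, sgn_of_nonneg hj, zpow_one, zpow_neg_one, inv_eq_iff_eq_inv] at he
    exact absurd he opposite_sign
  · rw [sgn_of_neg hi, sgn_of_neg hj, zpow_neg_one, zpow_neg_one, inv_inj] at he
    exact ⟨by have := same_sign he; omega, (same_sign he).2⟩

lemma IsGeneric.interpPoint_injective (h : IsGeneric q τ) (γ : Fin n → ℤ) :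
    Function.Injective (interpPoint q τ γ) := by
  intro i j he
  wlog hij : (sortPerm γ).symm i ≤ (sortPerm γ).symm j generalizing i j
  · exact (this he.symm (le_of_not_ge hij)).symm
  have hle : (γ j).natAbs ≤ (γ i).natAbs := by
    have := mt sortPerm_symm_lt_iff.mpr hij.not_gt
    rw [sortKey_lt_sortKey_iff] at this
    omega
  exact (sortPerm γ).symm.injective
    (h.eq_of_interpPoint_eq hle (sortPerm_symm_le_iff_corank_le.mp hij) he).2

lemma IsGeneric.interpPoint_sq_ne_one (h : IsGeneric q τ) (γ : Fin n → ℤ) (i : Fin n) :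
    interpPoint q τ γ i ^ 2 ≠ 1 := by
  rw [interpPoint_eq_zpow_sgn, ← zpow_natCast, zpow_comm, Ne, zpow_sgn_eq_one_iff,
    zpow_natCast, mul_pow, ← pow_mul, sq (τ _)]
  exact h.mul_ne_one _ _ _

end InterpPoint

/-! ### The principal specialization -/

section PrincipalPoint

variable {n : ℕ} {q s t : ℂ}

lemma principalPoint_sortPerm_symm (s t : ℂ) (γ : Fin n → ℤ) (i : Fin n) :
    principalPoint s t ((sortPerm γ).symm i) = s * t ^ corank γ i := by
  rw [principalPoint, corank_eq]

lemma eq_zero_of_pow_mul_pow_eq_one (hq1 : ‖q‖ < 1) (ht1 : ‖t‖ < 1) {a k : ℕ}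
    (h : q ^ a * t ^ k = 1) : a = 0 ∧ k = 0 := by
  by_contra hne
  have hn : ‖q‖ ^ a * ‖t‖ ^ k = 1 := by rw [← norm_pow, ← norm_pow, ← norm_mul, h, norm_one]
  rcases Nat.eq_zero_or_pos a with rfl | ha
  · have hk : k ≠ 0 := fun hk => hne ⟨rfl, hk⟩
    rw [pow_zero, one_mul] at hn
    exact (pow_lt_one₀ (norm_nonneg t) ht1 hk).ne hn
  · exact (mul_lt_one_of_nonneg_of_lt_one_left (by positivity)
      (pow_lt_one₀ (norm_nonneg q) hq1 ha.ne') (pow_le_one₀ (norm_nonneg t) ht1.le)).ne hn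

lemma isGeneric_principalPoint (hq : q ≠ 0) (hq1 : ‖q‖ < 1) (hs : s ≠ 0) (hs1 : ‖s‖ < 1)
    (ht : t ≠ 0) (ht1 : ‖t‖ < 1) : IsGeneric q (principalPoint (n := n) s t) where
  q_ne_zero := hq
  ne_zero i := mul_ne_zero hs (pow_ne_zero _ ht)
  mul_ne_one a i j h := by
    have hst : ‖s ^ 2 * t ^ (n - (i + 1) + (n - (j + 1)))‖ < 1 := by
      rw [norm_mul, norm_pow, norm_pow]
      exact mul_lt_one_of_nonneg_of_lt_one_left (by positivity)
        (pow_lt_one₀ (norm_nonneg s) hs1 two_ne_zero) (pow_le_one₀ (norm_nonneg t) ht1.le)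
    refine one_ne_zero (eq_zero_of_pow_mul_pow_eq_one hq1 hst (a := a) (k := 1) ?_).2
    rw [← h, principalPoint, principalPoint]
    ring
  eq_of_mul_eq a i j hij h := by
    have hexp : n - ((i : ℕ) + 1) = (j - i) + (n - (j + 1)) := by
      have := Fin.le_def.mp hij
      omega
    have hcancel : q ^ a * t ^ ((j : ℕ) - i) = 1 := by
      apply mul_right_cancel₀ (mul_ne_zero hs (pow_ne_zero (n - ((j : ℕ) + 1)) ht))
      calc q ^ a * t ^ ((j : ℕ) - i) * (s * t ^ (n - ((j : ℕ) + 1)))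
          = q ^ a * principalPoint s t i := by rw [principalPoint, hexp]; ring
        _ = 1 * (s * t ^ (n - ((j : ℕ) + 1))) := by rw [h, one_mul, principalPoint]
    have := eq_zero_of_pow_mul_pow_eq_one hq1 ht1 hcancel
    exact ⟨this.1, Fin.ext (by have := Fin.le_def.mp hij; omega)⟩

end PrincipalPoint

/-! ### Newton polynomials -/

section NewtonPoly

variable {n : ℕ} {q : ℂ} {τ : Fin n → ℂ} {α β : Fin n → ℤ}

/-- The integers which precede `b` in the enumeration `0, -1, 1, -2, 2, …`. -/
def newtonNodes (b : ℤ) : Finset ℤ := (Finset.Ico (-b.natAbs : ℤ) b.natAbs).erase b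

lemma mem_newtonNodes_iff_sortKey_lt {i : Fin n} :
    β i ∈ newtonNodes (α i) ↔ sortKey α i < sortKey β i := by
  rw [newtonNodes, Finset.mem_erase, Finset.mem_Ico, sortKey_lt_sortKey_iff]
  omega

lemma card_newtonNodes_filter_nonneg (b : ℤ) :
    ((newtonNodes b).filter (0 ≤ ·)).card ≤ b.natAbs := by
  refine (Finset.card_le_card (t := Finset.Ico 0 (b.natAbs : ℤ)) fun a ha => ?_).trans_eq
    (by rw [Int.card_Ico]; omega)
  simp only [newtonNodes, Finset.mem_filter, Finset.mem_erase, Finset.mem_Ico] at ha ⊢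
  exact ⟨ha.2, ha.1.2.2⟩

lemma card_newtonNodes_filter_neg (b : ℤ) :
    ((newtonNodes b).filter (· < 0)).card ≤ b.natAbs := by
  refine (Finset.card_le_card (t := Finset.Ico (-b.natAbs : ℤ) 0) fun a ha => ?_).trans_eq
    (by rw [Int.card_Ico]; omega)
  simp only [newtonNodes, Finset.mem_filter, Finset.mem_erase, Finset.mem_Ico] at ha ⊢
  exact ⟨ha.1.2.1, ha.2⟩

/-- The Newton basis polynomial of index `α`, a product of the factors `1 - (y / xᵢ)^sgn(a)`, where
`a` precedes `αᵢ` in the enumeration `0, -1, 1, -2, 2, …`, and `y` is the `i`-th coordinate of the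
interpolation point of the vector obtained from `α` by replacing `αᵢ` with `a`. -/
def newtonPoly (q : ℂ) (τ : Fin n → ℂ) (α : Fin n → ℤ) : LaurentPoly n :=
  ∏ i, ∏ a ∈ newtonNodes (α i), (1 -
    interpPoint q τ (Function.update α i a) i ^ sgn a • mono (Pi.single i (-sgn a)))

lemma one_sub_smul_mono_mem_supported_Icc (c : ℂ) (i : Fin n) (a : ℤ) :
    1 - c • mono (Pi.single i (-sgn a)) ∈ AddMonoidAlgebra.supported ℂ ℂ
      (Set.Icc (Pi.single i (if 0 ≤ a then -1 else 0)) (Pi.single i (if a < 0 then 1 else 0))) := by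
  rw [AddMonoidAlgebra.supported_eq_span_single]
  refine sub_mem (Submodule.subset_span ⟨0, ?_, rfl⟩)
    (Submodule.smul_mem _ _ (Submodule.subset_span ⟨Pi.single i (-sgn a), ?_, rfl⟩))
  · rw [Set.mem_Icc, Pi.single_nonpos, Pi.single_nonneg]
    split_ifs <;> omega
  · rw [Set.mem_Icc, Pi.single_le_single, Pi.single_le_single, sgn]
    split_ifs <;> omega

lemma newtonPoly_mem_degSubmodule (q : ℂ) (τ : Fin n → ℂ) (α : Fin n → ℤ) :
    newtonPoly q τ α ∈ degSubmodule n (weight α) := by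
  refine AddMonoidAlgebra.supported_mono (fun γ hγ => ?_) <|
    prod_mem_supported_Icc (s := Finset.univ) fun i _ =>
      prod_mem_supported_Icc (s := newtonNodes (α i)) fun a _ =>
        one_sub_smul_mono_mem_supported_Icc _ i a
  change weight γ ≤ weight α
  refine Finset.sum_le_sum fun k _ => ?_
  have hlo : _ ≤ γ k := hγ.1 k
  have hhi : γ k ≤ _ := hγ.2 k
  have hsingle (f : ℤ → ℤ) : (∑ i, ∑ a ∈ newtonNodes (α i), Pi.single i (f a) : Fin n → ℤ) k =
      ∑ a ∈ newtonNodes (α k), f a := by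
    rw [Finset.sum_apply, Finset.sum_eq_single_of_mem k (Finset.mem_univ k)]
    · simp only [Finset.sum_apply, Pi.single_eq_same]
    · intro i _ hi
      simp only [Finset.sum_apply, Pi.single_eq_of_ne hi.symm, Finset.sum_const_zero]
  rw [hsingle, ← Finset.sum_filter, Finset.sum_const, nsmul_eq_mul] at hlo hhi
  have := card_newtonNodes_filter_nonneg (α k)
  have := card_newtonNodes_filter_neg (α k)
  omega

lemma evalAt_newtonPoly_eq_zero_iff {x : Fin n → ℂ} (hx : ∀ i, x i ≠ 0) :
    evalAt x (newtonPoly q τ α) = 0 ↔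
      ∃ i, ∃ a ∈ newtonNodes (α i), interpPoint q τ (Function.update α i a) i = x i := by
  simp only [← evalHom_apply x hx, newtonPoly, map_prod, Finset.prod_eq_zero_iff, Finset.mem_univ,
    true_and, map_sub, map_one, map_smul, evalHom_mono_single, smul_eq_mul, zpow_neg,
    ← div_eq_mul_inv, ← div_zpow, sub_eq_zero, eq_comm (a := (1 : ℂ)), zpow_sgn_eq_one_iff,
    div_eq_one_iff_eq (hx _)]

lemma IsGeneric.evalAt_newtonPoly_self_ne_zero (h : IsGeneric q τ) (α : Fin n → ℤ) :
    evalAt (interpPoint q τ α) (newtonPoly q τ α) ≠ 0 := by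
  rw [Ne, evalAt_newtonPoly_eq_zero_iff (h.interpPoint_ne_zero α)]
  rintro ⟨i, a, ha, he⟩
  have hself : Function.update α i a i = a := Function.update_self i a α
  rw [newtonNodes, Finset.mem_erase, Finset.mem_Ico] at ha
  have hkey : sortKey α i < sortKey (Function.update α i a) i := by
    rw [sortKey_lt_sortKey_iff, hself]
    omega
  have hcorank : corank (Function.update α i a) i ≤ corank α i := by
    refine Finset.card_le_card fun l hl => ?_
    simp only [Finset.mem_filter, Finset.mem_univ, true_and] at hl ⊢
    rcases eq_or_ne l i with rfl | hli
    · exact absurd hl (lt_irrefl _)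
    · exact hkey.trans (hl.trans_eq (sortKey_congr (Function.update_of_ne hli a α)))
  have := (h.eq_of_interpPoint_eq (by rw [hself]; omega) hcorank he.symm).1
  exact ha.1 (by rw [this, hself])

/-- The set of the sorting keys of `α`. The evaluation of the Newton polynomials is triangular with
respect to the colexicographic order of these sets. -/
def keySet (α : Fin n → ℤ) : Finset (ℤ ×ₗ ℤ) := Finset.univ.image (sortKey α)

lemma sortKey_mem_keySet_iff {i : Fin n} :
    sortKey α i ∈ keySet β ↔ sortKey α i = sortKey β i := by
  rw [keySet, Finset.mem_image]
  refine ⟨?_, fun h => ⟨i, Finset.mem_univ i, h.symm⟩⟩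
  rintro ⟨l, -, h⟩
  have hl := (sortKey_eq_sortKey_iff.mp h).1
  rw [← h, hl]

lemma keySet_injective : Function.Injective (keySet (n := n)) := by
  intro α β h
  ext i
  have hi : sortKey α i ∈ keySet β := h ▸ Finset.mem_image_of_mem _ (Finset.mem_univ i)
  exact (sortKey_eq_sortKey_iff.mp (sortKey_mem_keySet_iff.mp hi)).2

lemma exists_sortKey_lt_of_keySet_lt (h : toColex (keySet α) < toColex (keySet β)) :
    ∃ i, sortKey α i < sortKey β i ∧
      ∀ l, sortKey β i < sortKey α l ↔ sortKey β i < sortKey β l := by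
  obtain ⟨κ, hκ, habove⟩ := Finset.Colex.lt_iff_exists_filter_lt.mp h
  obtain ⟨hκβ, hκα⟩ := Finset.mem_sdiff.mp hκ
  obtain ⟨i, -, rfl⟩ := Finset.mem_image.mp hκβ
  have hagree l : sortKey β i < sortKey α l ↔ sortKey β i < sortKey β l := by
    have hα := Finset.ext_iff.mp habove (sortKey α l)
    have hβ := Finset.ext_iff.mp habove (sortKey β l)
    simp only [Finset.mem_filter, sortKey_mem_keySet_iff, true_and] at hα hβ
    exact ⟨fun hl => (hα.mp hl).1 ▸ hl, fun hl => (hβ.mpr hl).1 ▸ hl⟩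
  refine ⟨i, lt_of_le_of_ne (not_lt.mp fun hi => ?_) fun hi => hκα ?_, hagree⟩
  · exact lt_irrefl _ ((hagree i).mp hi)
  · exact sortKey_mem_keySet_iff.mpr hi.symm

lemma evalAt_newtonPoly_eq_zero_of_keySet_lt (hβ : ∀ i, interpPoint q τ β i ≠ 0)
    (h : toColex (keySet α) < toColex (keySet β)) :
    evalAt (interpPoint q τ β) (newtonPoly q τ α) = 0 := by
  obtain ⟨i, hlt, hagree⟩ := exists_sortKey_lt_of_keySet_lt h
  refine (evalAt_newtonPoly_eq_zero_iff hβ).mpr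
    ⟨i, β i, mem_newtonNodes_iff_sortKey_lt.mpr hlt, ?_⟩
  have hself : Function.update α i (β i) i = β i := Function.update_self i _ α
  refine interpPoint_congr hself (corank_congr (Equiv.refl _) fun l => ?_)
  rw [Equiv.refl_apply, Equiv.refl_apply, sortKey_congr hself]
  rcases eq_or_ne l i with rfl | hli
  · rw [sortKey_congr hself]
  · rw [sortKey_congr (Function.update_of_ne hli _ α), hagree l]

end NewtonPoly

/-! ### Existence and uniqueness of interpolation polynomials -/

section Interpolation

open Module in
lemma bijective_of_triangular {K V ι κ : Type*} [Field K] [AddCommGroup V] [Module K V]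
    [FiniteDimensional K V] [Fintype ι] [LinearOrder κ] (φ : V →ₗ[K] ι → K)
    (hdim : finrank K V = Fintype.card ι) (v : ι → V) {b : ι → κ} (hb : Function.Injective b)
    (hzero : ∀ i j, b i < b j → φ (v i) j = 0) (hdiag : ∀ i, φ (v i) i ≠ 0) :
    Function.Bijective φ := by
  let : LinearOrder ι := LinearOrder.lift' b hb
  let M : Matrix ι ι K := Matrix.of fun i => φ (v i)
  have hM : IsUnit M := by
    rw [Matrix.isUnit_iff_isUnit_det, isUnit_iff_ne_zero,
      Matrix.det_of_isLowerTriangular M fun i j hij => hzero i j hij]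
    exact Finset.prod_ne_zero_iff.mpr fun i _ => hdiag i
  have hsurj : Function.Surjective φ := by
    intro y
    obtain ⟨c, rfl⟩ := Matrix.vecMul_surjective_iff_isUnit.mpr hM y
    refine ⟨∑ i, c i • v i, ?_⟩
    simp only [map_sum, map_smul, Matrix.vecMul_eq_sum]
    rfl
  have hdim' : finrank K V = finrank K (ι → K) := by rw [hdim, finrank_fintype_fun_eq_card]
  exact ⟨(LinearMap.injective_iff_surjective_of_finrank_eq_finrank hdim').mpr hsurj, hsurj⟩

variable {n : ℕ} {q : ℂ} {τ : Fin n → ℂ} {α : Fin n → ℤ}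

theorem IsGeneric.existsUnique_evalAt_eq (h : IsGeneric q τ) (d : ℕ) (c : (Fin n → ℤ) → ℂ) :
    ∃! f, f ∈ degSubmodule n d ∧
      ∀ γ, weight γ ≤ d → evalAt (interpPoint q τ γ) f = c γ := by
  let ι := {γ : Fin n → ℤ | weight γ ≤ d}
  have : Fintype ι := (finite_setOf_weight_le n d).fintype
  let e : degSubmodule n d ≃ₗ[ℂ] (ι →₀ ℂ) := AddMonoidAlgebra.supportedEquivFinsupp ι
  have : FiniteDimensional ℂ (degSubmodule n d) := e.symm.finiteDimensional
  let φ : degSubmodule n d →ₗ[ℂ] ι → ℂ := LinearMap.pi fun γ =>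
    (evalHom _ (h.interpPoint_ne_zero γ)).toLinearMap ∘ₗ (degSubmodule n d).subtype
  have hφ f γ : φ f γ = evalAt (interpPoint q τ γ) f :=
    evalHom_apply _ (h.interpPoint_ne_zero γ) f
  have hbij : Function.Bijective φ := by
    refine bijective_of_triangular φ (e.finrank_eq.trans (Module.finrank_finsupp_self ℂ))
      (fun γ => ⟨newtonPoly q τ γ, degSubmodule_mono γ.2 (newtonPoly_mem_degSubmodule q τ γ)⟩)
      (b := fun γ => toColex (keySet γ.1))
      (toColex.injective.comp (keySet_injective.comp Subtype.val_injective))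
      (fun γ δ hlt => ?_) fun γ => ?_
    · rw [hφ]
      exact evalAt_newtonPoly_eq_zero_of_keySet_lt (h.interpPoint_ne_zero δ) hlt
    · rw [hφ]
      exact h.evalAt_newtonPoly_self_ne_zero γ
  have hφ_eq_iff f : φ f = (fun γ : ι => c γ) ↔
      ∀ γ, weight γ ≤ d → evalAt (interpPoint q τ γ) f = c γ := by
    simp only [funext_iff, hφ, Subtype.forall]
    rfl
  obtain ⟨f, hf⟩ := hbij.surjective fun γ : ι => c γ
  refine ⟨f, ⟨f.2, (hφ_eq_iff f).mp hf⟩, fun g hg => ?_⟩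
  exact congrArg Subtype.val
    (hbij.injective (((hφ_eq_iff ⟨g, hg.1⟩).mpr hg.2).trans hf.symm))

theorem IsGeneric.eq_of_evalAt_eq (h : IsGeneric q τ) {d : ℕ} {f g : LaurentPoly n}
    (hf : f ∈ degSubmodule n d) (hg : g ∈ degSubmodule n d)
    (hfg : ∀ γ, weight γ ≤ d → evalAt (interpPoint q τ γ) f = evalAt (interpPoint q τ γ) g) :
    f = g :=
  (h.existsUnique_evalAt_eq d _).unique ⟨hf, hfg⟩ ⟨hg, fun _ _ => rfl⟩

lemma isInterp_iff {f : LaurentPoly n} : IsInterp q τ α f ↔ f ∈ degSubmodule n (weight α) ∧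
    ∀ γ, weight γ ≤ weight α → evalAt (interpPoint q τ γ) f = if γ = α then 1 else 0 := by
  rw [IsInterp, mem_degSubmodule]
  refine and_congr_right fun _ => ⟨fun h γ hγ => ?_, fun h => ⟨?_, fun γ hγ hne => ?_⟩⟩
  · split_ifs with hα
    · rw [hα, h.1]
    · exact h.2 γ hγ hα
  · rw [h α le_rfl, if_pos rfl]
  · rw [h γ hγ, if_neg hne]

theorem IsGeneric.existsUnique_isInterp (h : IsGeneric q τ) (α : Fin n → ℤ) :
    ∃! f, IsInterp q τ α f := by
  simp only [isInterp_iff]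
  exact h.existsUnique_evalAt_eq (weight α) _

lemma IsGeneric.isInterp_G {s t : ℂ} (h : IsGeneric q (principalPoint (n := n) s t))
    (α : Fin n → ℤ) : IsInterp q (principalPoint s t) α (G q s t α) :=
  Classical.epsilon_spec (h.existsUnique_isInterp α).exists

end Interpolation

/-! ### The simple reflections -/

section Reflections

variable {m : ℕ} (j : Fin m) (γ : Fin (m + 1) → ℤ) {i : Fin (m + 1)}

lemma simpleRefl_apply (i : Fin (m + 1)) :
    simpleRefl j γ i = γ (Equiv.swap j.castSucc j.succ i) := rfl

lemma lastRefl_apply_last : lastRefl m γ (Fin.last m) = -γ (Fin.last m) := if_pos rfl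

lemma lastRefl_apply_of_ne (h : i ≠ Fin.last m) : lastRefl m γ i = γ i := if_neg h

lemma simpleRefl_eq_sub_smul : simpleRefl j γ =
    γ - (γ j.castSucc - γ j.succ) • (Pi.single j.castSucc 1 - Pi.single j.succ 1) := by
  have hne : j.castSucc ≠ j.succ := Fin.castSucc_lt_succ.ne
  ext i
  rw [simpleRefl_apply]
  rcases eq_or_ne i j.castSucc with rfl | h1
  · simp [hne]
  · rcases eq_or_ne i j.succ with rfl | h2
    · simp [hne.symm]
    · simp [Equiv.swap_apply_of_ne_of_ne h1 h2, h1, h2]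

lemma lastRefl_eq_sub_smul :
    lastRefl m γ = γ - γ (Fin.last m) • Pi.single (Fin.last m) 2 := by
  ext i
  rcases eq_or_ne i (Fin.last m) with rfl | hi
  · rw [lastRefl_apply_last, Pi.sub_apply, Pi.smul_apply, Pi.single_eq_same, smul_eq_mul]
    ring
  · simp [lastRefl_apply_of_ne γ hi, hi]

lemma simpleRefl_eq_self_iff : simpleRefl j γ = γ ↔ γ j.castSucc = γ j.succ := by
  refine ⟨fun h => ?_, fun h => ?_⟩
  · rw [← congrFun h j.castSucc, simpleRefl_apply, Equiv.swap_apply_left]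
  · rw [simpleRefl_eq_sub_smul, h, sub_self, zero_smul, sub_zero]

lemma lastRefl_eq_self_iff : lastRefl m γ = γ ↔ γ (Fin.last m) = 0 := by
  refine ⟨fun h => ?_, fun h => ?_⟩
  · rw [← neg_eq_self, ← lastRefl_apply_last, h]
  · rw [lastRefl_eq_sub_smul, h, zero_smul, sub_zero]

lemma simpleRefl_simpleRefl : simpleRefl j (simpleRefl j γ) = γ := by
  ext i
  rw [simpleRefl_apply, simpleRefl_apply, Equiv.swap_apply_self]

lemma lastRefl_lastRefl : lastRefl m (lastRefl m γ) = γ := by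
  rw [lastRefl_eq_sub_smul, lastRefl_apply_last, neg_smul, sub_neg_eq_add,
    lastRefl_eq_sub_smul, sub_add_cancel]

lemma weight_simpleRefl : weight (simpleRefl j γ) = weight γ :=
  Equiv.sum_comp (Equiv.swap j.castSucc j.succ) fun i => (γ i).natAbs

lemma weight_lastRefl : weight (lastRefl m γ) = weight γ := by
  refine Finset.sum_congr rfl fun i _ => ?_
  rcases eq_or_ne i (Fin.last m) with rfl | hi
  · rw [lastRefl_apply_last, Int.natAbs_neg]
  · rw [lastRefl_apply_of_ne γ hi]

end Reflections

/-! ### The operators preserve the degree -/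

section Degree

variable {n m d : ℕ} {γ δ ε ρ : Fin n → ℤ}

lemma weight_le_of_smul_eq {a b : ℕ} (hab : 0 < a + b) (h : (a + b) • ε = a • γ + b • δ)
    (hγ : weight γ ≤ d) (hδ : weight δ ≤ d) : weight ε ≤ d := by
  refine Nat.le_of_mul_le_mul_left ?_ hab
  calc (a + b) * weight ε
      = ∑ i, (((a + b) • ε) i).natAbs := by
        simp only [weight, Finset.mul_sum, Pi.smul_apply, nsmul_eq_mul, Int.natAbs_mul,
          Int.natAbs_natCast]
    _ = ∑ i, ((a • γ + b • δ) i).natAbs := by rw [h]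
    _ ≤ ∑ i, (a * (γ i).natAbs + b * (δ i).natAbs) := by
        refine Finset.sum_le_sum fun i _ => (Int.natAbs_add_le _ _).trans_eq ?_
        simp only [Pi.smul_apply, nsmul_eq_mul, Int.natAbs_mul, Int.natAbs_natCast]
    _ = a * weight γ + b * weight δ := by
        rw [Finset.sum_add_distrib, ← Finset.mul_sum, ← Finset.mul_sum, weight, weight]
    _ ≤ a * d + b * d := by gcongr
    _ = (a + b) * d := (add_mul a b d).symm

lemma mono_sub_smul_sub_mono (γ δ ρ : Fin n → ℤ) (k : ℕ) : mono (γ - k • ρ) - mono γ =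
    (mono δ - mono (δ - ρ)) * -∑ i ∈ Finset.range k, mono (γ - i • ρ - δ) := by
  rw [mul_neg, Finset.mul_sum, ← Finset.sum_neg_distrib]
  convert (Finset.sum_range_sub (fun i : ℕ => mono (γ - i • ρ)) k).symm using 2 with i
  · rw [zero_smul, sub_zero]
  · rw [sub_mul, ← mono_add, ← mono_add, neg_sub, add_smul, one_smul]
    congr 2 <;> abel

/-- The monomials of the quotient lie on the segment from `γ - δ` to `γ' - δ`, and multiplication
by `x^(δ - ε)` moves them to the segment from `γ` to `γ'`, where the weight is at most `d` by
convexity. -/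
lemma exists_mono_sub_mono_eq_mul {γ' : Fin n → ℤ} {c : ℤ} (h : γ' = γ - c • ρ)
    (hγ : weight γ ≤ d) (hγ' : weight γ' ≤ d) (δ : Fin n → ℤ) :
    ∃ g, mono γ' - mono γ = (mono δ - mono (δ - ρ)) * g ∧
      ∀ (a N : ℕ) (ε : Fin n → ℤ), a ≤ N → 0 < N → N • ε = a • ρ →
        mono (δ - ε) * g ∈ degSubmodule n d := by
  wlog hc : 0 ≤ c generalizing γ γ' c
  · obtain ⟨g, hg, hmem⟩ := this (γ := γ') (γ' := γ) (c := -c) (by rw [h]; module) hγ' hγ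
      (by omega)
    refine ⟨-g, by rw [mul_neg, ← hg, neg_sub], fun a N ε haN hN hε => ?_⟩
    rw [mul_neg, neg_mem_iff]
    exact hmem a N ε haN hN hε
  lift c to ℕ using hc
  rw [natCast_zsmul] at h
  refine ⟨_, by rw [h, mono_sub_smul_sub_mono γ δ], fun a N ε haN hN hε => ?_⟩
  rw [mul_neg, neg_mem_iff, Finset.mul_sum]
  refine sum_mem fun i hi => ?_
  rw [Finset.mem_range] at hi
  rw [← mono_add]
  obtain ⟨r, hr⟩ : ∃ r, N * c = r + (N * i + a) :=
    Nat.exists_eq_add_of_le' ((by gcongr : _ ≤ N * i + N).trans (Nat.mul_le_mul_left N hi))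
  refine mono_mem_degSubmodule (weight_le_of_smul_eq (a := r) (b := N * i + a) ?_ ?_ hγ hγ')
  · rw [← hr]
    exact Nat.mul_pos hN (by omega)
  · have hr' : (N * c : ℤ) = r + (N * i + a) := mod_cast hr
    ext l
    have hεl := congrFun hε l
    simp only [h, Pi.add_apply, Pi.sub_apply, Pi.smul_apply] at hεl ⊢
    simp only [nsmul_eq_mul, Nat.cast_add, Nat.cast_mul] at hεl ⊢
    linear_combination (i * ρ l + ε l) * hr' - c * hεl

lemma mono_mul_dividedDiff_mono_mem (w : (Fin n → ℤ) →+ (Fin n → ℤ)) {b : LaurentPoly n}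
    (hb : b ≠ 0) (h : ∀ f, b ∣ act w f - f) (hbδ : b = mono δ - mono (δ - ρ)) {c : ℤ}
    (hw : w γ = γ - c • ρ) (hγ : weight γ ≤ d) (hwγ : weight (w γ) ≤ d) {a N : ℕ} (haN : a ≤ N)
    (hN : 0 < N) (hε : N • ε = a • ρ) :
    mono (δ - ε) * dividedDiff w b hb h (mono γ) ∈ degSubmodule n d := by
  obtain ⟨g, hg, hmem⟩ := exists_mono_sub_mono_eq_mul hw hγ hwγ δ
  have : dividedDiff w b hb h (mono γ) = g := by
    apply mul_left_cancel₀ hb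
    rw [mul_dividedDiff, act_mono, hg, hbδ]
  rw [this]
  exact hmem a N ε haN hN hε

lemma demazureLusztig_mem_degSubmodule (t : ℂ) (j : Fin m) {f : LaurentPoly (m + 1)}
    (hf : f ∈ degSubmodule (m + 1) d) : demazureLusztig t j f ∈ degSubmodule (m + 1) d := by
  refine map_mem_degSubmodule (fun γ hγ => ?_) hf
  have hmem {a : ℕ} {ε : Fin (m + 1) → ℤ} (ha : a ≤ 1)
      (hε : 1 • ε = a • (Pi.single j.castSucc 1 - Pi.single j.succ 1)) :=
    mono_mul_dividedDiff_mono_mem (simpleRefl j) (X_sub_X_ne_zero j) (dvd_simpleRefl j)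
      (δ := Pi.single j.castSucc 1) (by rw [sub_sub_cancel, X, X]) (simpleRefl_eq_sub_smul j γ) hγ
      ((weight_simpleRefl j γ).trans_le hγ) ha one_pos hε
  have h0 := hmem (a := 0) (ε := 0) zero_le_one (by simp)
  have h1 := hmem (a := 1) le_rfl rfl
  rw [sub_zero] at h0
  rw [sub_sub_cancel] at h1
  simp only [demazureLusztig, LinearMap.add_apply, LinearMap.smul_apply, LinearMap.id_apply,
    LinearMap.comp_apply, LinearMap.mulLeft_apply, sub_mul, smul_mul_assoc]
  exact add_mem (Submodule.smul_mem _ _ (mono_mem_degSubmodule hγ))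
    (sub_mem h0 (Submodule.smul_mem _ _ h1))

lemma demazureLusztigLast_mem_degSubmodule (s : ℂ) {f : LaurentPoly (m + 1)}
    (hf : f ∈ degSubmodule (m + 1) d) : demazureLusztigLast m s f ∈ degSubmodule (m + 1) d := by
  refine map_mem_degSubmodule (fun γ hγ => ?_) hf
  set g := dividedDiff (lastRefl m) _ (one_sub_Xinv_sq_ne_zero (Fin.last m)) dvd_lastRefl (mono γ)
    with hg
  have hmem {a : ℕ} (ha : a ≤ 2) : Xinv (Fin.last m) ^ a * g ∈ degSubmodule (m + 1) d := by
    rw [Xinv_pow, Pi.single_neg, ← zero_sub]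
    refine mono_mul_dividedDiff_mono_mem (lastRefl m) (one_sub_Xinv_sq_ne_zero (Fin.last m))
      dvd_lastRefl ?_ (lastRefl_eq_sub_smul γ) hγ ((weight_lastRefl γ).trans_le hγ) ha two_pos ?_
    · rw [Xinv_pow, mono_zero, zero_sub, ← Pi.single_neg, Nat.cast_two]
    · rw [← Pi.single_smul, ← Pi.single_smul, nsmul_eq_mul, nsmul_eq_mul, mul_comm, Nat.cast_two]
  have hvalue : demazureLusztigLast m s (mono γ) = -mono γ +
      (Xinv (Fin.last m) ^ 0 * g - (s + s⁻¹) • (Xinv (Fin.last m) ^ 1 * g) +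
        (s * s⁻¹) • (Xinv (Fin.last m) ^ 2 * g)) := by
    simp only [demazureLusztigLast, LinearMap.add_apply, LinearMap.neg_apply, LinearMap.id_apply,
      LinearMap.comp_apply, LinearMap.mulLeft_apply, ← hg, Algebra.smul_def, map_add, map_mul]
    ring
  rw [hvalue]
  exact add_mem (neg_mem (mono_mem_degSubmodule hγ))
    (add_mem (sub_mem (hmem zero_le_two) (Submodule.smul_mem _ _ (hmem one_le_two)))
      (Submodule.smul_mem _ _ (hmem le_rfl)))

end Degree

/-! ### Interpolation points and the simple reflections -/

section InterpPointReflections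

variable {m : ℕ} {q s t : ℂ} {τ : Fin (m + 1) → ℂ} {j : Fin m} {γ : Fin (m + 1) → ℤ}

lemma corank_simpleRefl (h : simpleRefl j γ ≠ γ) (i : Fin (m + 1)) :
    corank (simpleRefl j γ) i = corank γ (Equiv.swap j.castSucc j.succ i) := by
  rw [Ne, simpleRefl_eq_self_iff] at h
  refine corank_congr (Equiv.swap j.castSucc j.succ) fun l => ?_
  have hswap (k : Fin (m + 1)) :
      k = j.castSucc ∧ Equiv.swap j.castSucc j.succ k = j.succ ∨
      k = j.succ ∧ Equiv.swap j.castSucc j.succ k = j.castSucc ∨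
      (k : ℕ) ≠ j ∧ (k : ℕ) ≠ j + 1 ∧ Equiv.swap j.castSucc j.succ k = k := by
    have h1 : k = j.castSucc ↔ (k : ℕ) = j := Fin.ext_iff
    have h2 : k = j.succ ↔ (k : ℕ) = j + 1 := Fin.ext_iff
    rw [← not_iff_not] at h1 h2
    rw [Equiv.swap_apply_def]
    split_ifs <;> simp_all
  simp only [sortKey_lt_sortKey_iff, simpleRefl_apply]
  rcases hswap i with ⟨rfl, hi⟩ | ⟨rfl, hi⟩ | ⟨h1, h2, hi⟩ <;>
  rcases hswap l with ⟨rfl, hl⟩ | ⟨rfl, hl⟩ | ⟨h3, h4, hl⟩ <;>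
  simp only [hi, hl, Fin.val_castSucc, Fin.val_succ] <;> omega

lemma corank_lastRefl (γ : Fin (m + 1) → ℤ) (i : Fin (m + 1)) :
    corank (lastRefl m γ) i = corank γ i := by
  refine corank_congr (Equiv.refl _) fun l => ?_
  have hlast (k : Fin (m + 1)) : k = Fin.last m ∨ (k : ℕ) < m ∧ lastRefl m γ k = γ k :=
    (Fin.eq_castSucc_or_eq_last k).symm.imp_right fun ⟨k', hk⟩ =>
      ⟨hk ▸ k'.isLt, lastRefl_apply_of_ne γ (hk ▸ Fin.castSucc_ne_last k')⟩
  have hneg := lastRefl_apply_last γ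
  have hval := Fin.val_last m
  simp only [Equiv.refl_apply, sortKey_lt_sortKey_iff]
  rcases hlast i with rfl | ⟨hi, hi'⟩ <;> rcases hlast l with rfl | ⟨hl, hl'⟩ <;> omega

lemma interpPoint_simpleRefl (h : simpleRefl j γ ≠ γ) :
    interpPoint q τ (simpleRefl j γ) = interpPoint q τ γ ∘ Equiv.swap j.castSucc j.succ :=
  funext fun i => interpPoint_congr (simpleRefl_apply j γ i) (corank_simpleRefl h i)

lemma interpPoint_lastRefl (h : lastRefl m γ ≠ γ) : interpPoint q τ (lastRefl m γ) =
    Function.update (interpPoint q τ γ) (Fin.last m) (interpPoint q τ γ (Fin.last m))⁻¹ := by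
  refine Function.eq_update_iff.mpr ⟨?_, fun i hi =>
    interpPoint_congr (lastRefl_apply_of_ne γ hi) (corank_lastRefl γ i)⟩
  rw [Ne, lastRefl_eq_self_iff] at h
  have hπ : (sortPerm (lastRefl m γ)).symm (Fin.last m) = (sortPerm γ).symm (Fin.last m) :=
    le_antisymm (sortPerm_symm_le_iff_corank_le.mpr (corank_lastRefl γ _).ge)
      (sortPerm_symm_le_iff_corank_le.mpr (corank_lastRefl γ _).le)
  rw [interpPoint_eq_zpow_sgn, interpPoint_eq_zpow_sgn, lastRefl_apply_last, Int.natAbs_neg, hπ,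
    ← zpow_neg, sgn, sgn]
  congr 1
  split_ifs <;> omega

lemma interpPoint_last_of_lastRefl_eq_self (h : lastRefl m γ = γ) :
    interpPoint q (principalPoint s t) γ (Fin.last m) = s := by
  rw [lastRefl_eq_self_iff] at h
  have hcorank : corank γ (Fin.last m) = 0 := by
    rw [corank, Finset.card_eq_zero, Finset.filter_eq_empty_iff]
    intro l _
    rw [sortKey_lt_sortKey_iff, h, Fin.val_last]
    omega
  rw [interpPoint, principalPoint_sortPerm_symm, hcorank, h, sgn_of_nonneg le_rfl, pow_zero,
    mul_one, zpow_zero, zpow_one, one_mul]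

lemma interpPoint_castSucc_of_simpleRefl_eq_self (ht : t ≠ 0) (h : simpleRefl j γ = γ) :
    interpPoint q (principalPoint s t) γ j.castSucc =
      t * interpPoint q (principalPoint s t) γ j.succ := by
  rw [simpleRefl_eq_self_iff] at h
  rw [interpPoint, interpPoint, principalPoint_sortPerm_symm, principalPoint_sortPerm_symm, h]
  rcases le_or_gt 0 (γ j.succ) with h0 | h0
  · have hcorank : corank γ j.castSucc = corank γ j.succ + 1 := by
      refine corank_eq_succ fun l => ?_
      have hl : (l : ℕ) = j + 1 → γ l = γ j.succ := fun hl => congrArg γ (Fin.ext hl)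
      simp only [sortKey_lt_sortKey_iff, h, Fin.val_castSucc, Fin.val_succ, Fin.ext_iff]
      omega
    rw [hcorank, sgn_of_nonneg h0, zpow_one, zpow_one]
    ring
  · have hcorank : corank γ j.succ = corank γ j.castSucc + 1 := by
      refine corank_eq_succ fun l => ?_
      have hl : (l : ℕ) = j → γ l = γ j.succ := fun hl => h ▸ congrArg γ (Fin.ext hl)
      simp only [sortKey_lt_sortKey_iff, h, Fin.val_castSucc, Fin.val_succ, Fin.ext_iff]
      omega
    rw [hcorank, sgn_of_neg h0, pow_succ]
    field_simp

end InterpPointReflections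

/-! ### The action of the operators on interpolation polynomials -/

section Values

variable {n m : ℕ}

/-- The coefficient `(x - t y) / (x - y)` of `s_j - 1` in the operator `H_j^(t)`, as a function of
the values `x` and `y` of the variables `x_j` and `x_{j+1}`. -/
def longCoeff (t x y : ℂ) : ℂ := (x - t * y) / (x - y)

/-- The coefficient `(1 - s x) (1 - s⁻¹ x) / (1 - x²)` of `s_n - 1` in the operator `H_n^(s)`, as a
function of the value `x` of the inverse variable `x_n⁻¹`. -/
def shortCoeff (s x : ℂ) : ℂ := (1 - s * x) * (1 - s⁻¹ * x) / (1 - x ^ 2)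

lemma longCoeff_add_longCoeff_swap (t : ℂ) {x y : ℂ} (h : x ≠ y) :
    longCoeff t x y + longCoeff t y x = t + 1 := by
  have hxy := sub_ne_zero.mpr h
  rw [longCoeff, longCoeff, ← neg_sub x y, div_neg]
  field_simp
  ring

lemma shortCoeff_inv {s x : ℂ} (hs : s ≠ 0) (hx : x ≠ 0) : shortCoeff s x⁻¹ = -shortCoeff s x := by
  rw [shortCoeff, shortCoeff, ← div_neg, neg_sub, ← mul_div_mul_right _ _ (pow_ne_zero 2 hx)]
  congr 1 <;> field_simp
  ring

lemma evalHom_dividedDiff (w : (Fin n → ℤ) →+ (Fin n → ℤ)) {b : LaurentPoly n} (hb : b ≠ 0)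
    (h : ∀ f, b ∣ act w f - f) {x : Fin n → ℂ} (hx : ∀ i, x i ≠ 0) (hbx : evalHom x hx b ≠ 0)
    (f : LaurentPoly n) : evalHom x hx (dividedDiff w b hb h f) =
      (evalHom x hx (act w f) - evalHom x hx f) / evalHom x hx b := by
  rw [eq_div_iff hbx, ← map_sub, ← mul_dividedDiff w b hb h, map_mul, mul_comm]

lemma evalAt_act_simpleRefl (j : Fin m) {x : Fin (m + 1) → ℂ} (hx : ∀ i, x i ≠ 0)
    (f : LaurentPoly (m + 1)) :
    evalAt x (act (simpleRefl j) f) = evalAt (x ∘ Equiv.swap j.castSucc j.succ) f := by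
  rw [← evalHom_apply x hx, ← evalHom_apply (x ∘ _) fun i => hx _]
  refine evalHom_act _ hx _ (fun γ => ?_) f
  rw [← Equiv.prod_comp (Equiv.swap j.castSucc j.succ)]
  simp only [simpleRefl_apply, Equiv.swap_apply_self, Function.comp_apply]

lemma evalAt_act_lastRefl {x : Fin (m + 1) → ℂ} (hx : ∀ i, x i ≠ 0) (f : LaurentPoly (m + 1)) :
    evalAt x (act (lastRefl m) f) =
      evalAt (Function.update x (Fin.last m) (x (Fin.last m))⁻¹) f := by
  have hy (i) : Function.update x (Fin.last m) (x (Fin.last m))⁻¹ i ≠ 0 := by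
    rcases eq_or_ne i (Fin.last m) with rfl | hi
    · rw [Function.update_self]
      exact inv_ne_zero (hx _)
    · rw [Function.update_of_ne hi]
      exact hx i
  rw [← evalHom_apply x hx, ← evalHom_apply _ hy]
  refine evalHom_act _ hx _ (fun γ => Finset.prod_congr rfl fun i _ => ?_) f
  rcases eq_or_ne i (Fin.last m) with rfl | hi
  · rw [lastRefl_apply_last, Function.update_self, inv_zpow, zpow_neg]
  · rw [lastRefl_apply_of_ne γ hi, Function.update_of_ne hi]

lemma evalAt_demazureLusztig (t : ℂ) (j : Fin m) {x : Fin (m + 1) → ℂ} (hx : ∀ i, x i ≠ 0)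
    (hne : x j.castSucc ≠ x j.succ) (f : LaurentPoly (m + 1)) :
    evalAt x (demazureLusztig t j f) = t * evalAt x f +
      longCoeff t (x j.castSucc) (x j.succ) *
        (evalAt (x ∘ Equiv.swap j.castSucc j.succ) f - evalAt x f) := by
  have hb : evalHom x hx (X j.castSucc - X j.succ) = x j.castSucc - x j.succ := by
    rw [map_sub, evalHom_X, evalHom_X]
  rw [← evalAt_act_simpleRefl j hx, ← evalHom_apply x hx, ← evalHom_apply x hx,
    ← evalHom_apply x hx, longCoeff, div_mul_eq_mul_div, mul_div_assoc, ← hb,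
    ← evalHom_dividedDiff _ (X_sub_X_ne_zero j) (dvd_simpleRefl j) hx
      (hb ▸ sub_ne_zero.mpr hne)]
  simp only [demazureLusztig, LinearMap.add_apply, LinearMap.smul_apply, LinearMap.id_apply,
    LinearMap.comp_apply, LinearMap.mulLeft_apply, map_add, map_smul, map_mul, map_sub, evalHom_X,
    smul_eq_mul]

lemma evalAt_demazureLusztigLast (s : ℂ) {x : Fin (m + 1) → ℂ} (hx : ∀ i, x i ≠ 0)
    (hne : x (Fin.last m) ^ 2 ≠ 1) (f : LaurentPoly (m + 1)) :
    evalAt x (demazureLusztigLast m s f) = -1 * evalAt x f +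
      shortCoeff s (x (Fin.last m))⁻¹ *
        (evalAt (Function.update x (Fin.last m) (x (Fin.last m))⁻¹) f - evalAt x f) := by
  have hb : evalHom x hx (1 - Xinv (Fin.last m) ^ 2) = 1 - (x (Fin.last m))⁻¹ ^ 2 := by
    rw [map_sub, map_one, map_pow, evalHom_Xinv]
  have hbne : 1 - (x (Fin.last m))⁻¹ ^ 2 ≠ 0 := by
    rwa [inv_pow, sub_ne_zero, ne_comm, Ne, inv_eq_one]
  rw [← evalAt_act_lastRefl hx, ← evalHom_apply x hx, ← evalHom_apply x hx,
    ← evalHom_apply x hx, shortCoeff, div_mul_eq_mul_div, mul_div_assoc, ← hb,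
    ← evalHom_dividedDiff _ (one_sub_Xinv_sq_ne_zero _) dvd_lastRefl hx (hb ▸ hbne)]
  simp only [demazureLusztigLast, LinearMap.add_apply, LinearMap.neg_apply, LinearMap.id_apply,
    LinearMap.comp_apply, LinearMap.mulLeft_apply, map_add, map_neg, map_smul, map_mul, map_sub,
    map_one, evalHom_Xinv, smul_eq_mul, neg_one_mul]

end Values

section Hecke

lemma IsGeneric.map_eq_of_isInterp {n : ℕ} {q : ℂ} {τ : Fin n → ℂ} (h : IsGeneric q τ)
    {α : Fin n → ℤ} {w : (Fin n → ℤ) → Fin n → ℤ} (hw : Function.Involutive w)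
    (hweight : ∀ β, weight (w β) = weight β) {T : LaurentPoly n →ₗ[ℂ] LaurentPoly n}
    {κ : ℂ} {u : (Fin n → ℤ) → ℂ}
    (hT : ∀ f ∈ degSubmodule n (weight α), T f ∈ degSubmodule n (weight α))
    (hTu : ∀ β f, evalAt (interpPoint q τ β) (T f) = κ * evalAt (interpPoint q τ β) f +
      u β * (evalAt (interpPoint q τ (w β)) f - evalAt (interpPoint q τ β) f))
    {f g : LaurentPoly n} (hf : IsInterp q τ α f) (hg : IsInterp q τ (w α) g) :
    T f = (κ - u α) • f + u (w α) • g := by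
  rw [isInterp_iff] at hf hg
  rw [hweight] at hg
  refine h.eq_of_evalAt_eq (hT f hf.1)
    (add_mem (Submodule.smul_mem _ _ hf.1) (Submodule.smul_mem _ _ hg.1)) fun β hβ => ?_
  have hx := h.interpPoint_ne_zero β
  have hiff : w β = α ↔ β = w α := hw.eq_iff
  rw [hTu, hf.2 β hβ, hf.2 (w β) ((hweight β).trans_le hβ), ← evalHom_apply _ hx, map_add,
    map_smul, map_smul, evalHom_apply, evalHom_apply, hf.2 β hβ, hg.2 β hβ, smul_eq_mul,
    smul_eq_mul]
  simp only [hiff]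
  have hα : u β * (if β = α then 1 else 0) = u α * if β = α then 1 else 0 := by
    split_ifs with h <;> simp [h]
  have hwα : u β * (if β = w α then 1 else 0) = u (w α) * if β = w α then 1 else 0 := by
    split_ifs with h <;> simp [h]
  linear_combination hwα - hα

variable {m : ℕ} {q s t : ℂ} {j : Fin m} {α β : Fin (m + 1) → ℤ}

lemma IsGeneric.longCoeff_interpPoint_eq_zero
    (h : IsGeneric q (principalPoint (n := m + 1) s t)) (hβ : simpleRefl j β = β) :
    longCoeff t (interpPoint q (principalPoint s t) β j.castSucc)
      (interpPoint q (principalPoint s t) β j.succ) = 0 := by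
  have ht : t ≠ 0 :=
    (pow_ne_zero_iff (by rw [Fin.val_castSucc]; omega)).mp
      (right_ne_zero_of_mul (h.ne_zero j.castSucc))
  rw [longCoeff, interpPoint_castSucc_of_simpleRefl_eq_self ht hβ, sub_self, zero_div]

lemma IsGeneric.s_ne_zero (h : IsGeneric q (principalPoint (n := m + 1) s t)) : s ≠ 0 :=
  left_ne_zero_of_mul (h.ne_zero (Fin.last m))

lemma IsGeneric.shortCoeff_interpPoint_eq_zero
    (h : IsGeneric q (principalPoint (n := m + 1) s t)) (hβ : lastRefl m β = β) :
    shortCoeff s (interpPoint q (principalPoint s t) β (Fin.last m)) = 0 := by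
  rw [shortCoeff, interpPoint_last_of_lastRefl_eq_self hβ, inv_mul_cancel₀ h.s_ne_zero, sub_self,
    mul_zero, zero_div]

lemma IsGeneric.evalAt_interpPoint_demazureLusztig
    (h : IsGeneric q (principalPoint (n := m + 1) s t)) (j : Fin m) (β : Fin (m + 1) → ℤ)
    (f : LaurentPoly (m + 1)) :
    evalAt (interpPoint q (principalPoint s t) β) (demazureLusztig t j f) =
      t * evalAt (interpPoint q (principalPoint s t) β) f +
        longCoeff t (interpPoint q (principalPoint s t) β j.castSucc)
            (interpPoint q (principalPoint s t) β j.succ) *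
          (evalAt (interpPoint q (principalPoint s t) (simpleRefl j β)) f -
            evalAt (interpPoint q (principalPoint s t) β) f) := by
  rw [evalAt_demazureLusztig t j (h.interpPoint_ne_zero β)
    ((h.interpPoint_injective β).ne Fin.castSucc_lt_succ.ne)]
  by_cases hβ : simpleRefl j β = β
  · rw [h.longCoeff_interpPoint_eq_zero hβ, zero_mul, zero_mul]
  · rw [interpPoint_simpleRefl hβ]

lemma IsGeneric.evalAt_interpPoint_demazureLusztigLast
    (h : IsGeneric q (principalPoint (n := m + 1) s t)) (β : Fin (m + 1) → ℤ)
    (f : LaurentPoly (m + 1)) :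
    evalAt (interpPoint q (principalPoint s t) β) (demazureLusztigLast m s f) =
      -1 * evalAt (interpPoint q (principalPoint s t) β) f +
        shortCoeff s (interpPoint q (principalPoint s t) β (Fin.last m))⁻¹ *
          (evalAt (interpPoint q (principalPoint s t) (lastRefl m β)) f -
            evalAt (interpPoint q (principalPoint s t) β) f) := by
  rw [evalAt_demazureLusztigLast s (h.interpPoint_ne_zero β) (h.interpPoint_sq_ne_one β _)]
  by_cases hβ : lastRefl m β = β
  · rw [shortCoeff_inv h.s_ne_zero (h.interpPoint_ne_zero _ _),
      h.shortCoeff_interpPoint_eq_zero hβ, neg_zero, zero_mul, zero_mul]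
  · rw [interpPoint_lastRefl hβ]

lemma IsGeneric.demazureLusztig_G (h : IsGeneric q (principalPoint (n := m + 1) s t))
    (j : Fin m) (α : Fin (m + 1) → ℤ) : demazureLusztig t j (G q s t α) =
      (t - longCoeff t (interpPoint q (principalPoint s t) α j.castSucc)
        (interpPoint q (principalPoint s t) α j.succ)) • G q s t α +
      longCoeff t (interpPoint q (principalPoint s t) (simpleRefl j α) j.castSucc)
        (interpPoint q (principalPoint s t) (simpleRefl j α) j.succ) • G q s t (simpleRefl j α) :=
  h.map_eq_of_isInterp (simpleRefl_simpleRefl j) (weight_simpleRefl j)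
    (fun _ => demazureLusztig_mem_degSubmodule t j) (h.evalAt_interpPoint_demazureLusztig j)
    (h.isInterp_G α) (h.isInterp_G _)

lemma IsGeneric.demazureLusztig_G_of_simpleRefl_eq_self
    (h : IsGeneric q (principalPoint (n := m + 1) s t)) (hα : simpleRefl j α = α) :
    demazureLusztig t j (G q s t α) = t • G q s t α := by
  rw [h.demazureLusztig_G, hα, h.longCoeff_interpPoint_eq_zero hα, sub_zero, zero_smul, add_zero]

lemma IsGeneric.demazureLusztig_G_of_simpleRefl_ne
    (h : IsGeneric q (principalPoint (n := m + 1) s t)) (hα : simpleRefl j α ≠ α) :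
    demazureLusztig t j (G q s t α) = -G q s t α +
      longCoeff t (interpPoint q (principalPoint s t) α j.succ)
        (interpPoint q (principalPoint s t) α j.castSucc) •
          (G q s t (simpleRefl j α) + G q s t α) := by
  have hsum := longCoeff_add_longCoeff_swap t
    ((h.interpPoint_injective α).ne (Fin.castSucc_lt_succ (i := j)).ne)
  rw [h.demazureLusztig_G, interpPoint_simpleRefl hα, Function.comp_apply, Function.comp_apply,
    Equiv.swap_apply_left, Equiv.swap_apply_right, eq_sub_of_add_eq hsum]
  module

lemma IsGeneric.demazureLusztigLast_G (h : IsGeneric q (principalPoint (n := m + 1) s t))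
    (α : Fin (m + 1) → ℤ) : demazureLusztigLast m s (G q s t α) = -G q s t α +
      shortCoeff s (interpPoint q (principalPoint s t) α (Fin.last m)) •
        (G q s t (lastRefl m α) + G q s t α) := by
  have key := h.map_eq_of_isInterp lastRefl_lastRefl weight_lastRefl
    (fun _ => demazureLusztigLast_mem_degSubmodule s) h.evalAt_interpPoint_demazureLusztigLast
    (h.isInterp_G α) (h.isInterp_G _)
  have hcoeff : shortCoeff s (interpPoint q (principalPoint s t) (lastRefl m α) (Fin.last m))⁻¹ =
      shortCoeff s (interpPoint q (principalPoint s t) α (Fin.last m)) := by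
    by_cases hα : lastRefl m α = α
    · rw [hα, shortCoeff_inv h.s_ne_zero (h.interpPoint_ne_zero _ _),
        h.shortCoeff_interpPoint_eq_zero hα, neg_zero]
    · rw [interpPoint_lastRefl hα, Function.update_self, inv_inv]
  rw [key, hcoeff, shortCoeff_inv h.s_ne_zero (h.interpPoint_ne_zero _ _)]
  module

lemma IsGeneric.demazureLusztigLast_G_of_lastRefl_eq_self
    (h : IsGeneric q (principalPoint (n := m + 1) s t)) (hα : lastRefl m α = α) :
    demazureLusztigLast m s (G q s t α) = -G q s t α := by
  rw [h.demazureLusztigLast_G, h.shortCoeff_interpPoint_eq_zero hα, zero_smul, add_zero]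

end Hecke

end

end NonsymInterp

theorem mainTheorem4_general (m : ℕ) (q s t : ℂ)
    (h : IsGeneric q (principalPoint (n := m + 1) s t)) (α : Fin (m + 1) → ℤ)
    (a : Fin (m + 1) → ℂ) (ha : a = interpPoint q (principalPoint s t) α) :
    (IsInterp q (principalPoint s t) α (G q s t α) ∧
      ∀ f : LaurentPoly (m + 1), IsInterp q (principalPoint s t) α f → f = G q s t α) ∧
    (∀ j : Fin m,
      (simpleRefl j α = α → demazureLusztig t j (G q s t α) = t • G q s t α) ∧
      (simpleRefl j α ≠ α →
        a j.succ - a j.castSucc ≠ 0 ∧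
        demazureLusztig t j (G q s t α) = -G q s t α +
          ((a j.succ - t * a j.castSucc) / (a j.succ - a j.castSucc)) •
            (G q s t (simpleRefl j α) + G q s t α))) ∧
    (1 - a (Fin.last m) ^ 2 ≠ 0 ∧
      demazureLusztigLast m s (G q s t α) = -G q s t α +
        ((1 - s * a (Fin.last m)) * (1 - s⁻¹ * a (Fin.last m)) / (1 - a (Fin.last m) ^ 2)) •
          (G q s t (lastRefl m α) + G q s t α)) ∧
    (lastRefl m α = α → demazureLusztigLast m s (G q s t α) = -G q s t α) := by
  subst ha
  refine ⟨⟨h.isInterp_G α, fun f hf => (h.existsUnique_isInterp α).unique hf (h.isInterp_G α)⟩,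
    fun j => ⟨h.demazureLusztig_G_of_simpleRefl_eq_self,
      fun hα => ⟨?_, h.demazureLusztig_G_of_simpleRefl_ne hα⟩⟩,
    ⟨?_, h.demazureLusztigLast_G α⟩, h.demazureLusztigLast_G_of_lastRefl_eq_self⟩
  · exact sub_ne_zero.mpr ((h.interpPoint_injective α).ne Fin.castSucc_lt_succ.ne')
  · exact sub_ne_zero.mpr (h.interpPoint_sq_ne_one α (Fin.last m)).symm

theorem mainTheorem4 (m : ℕ) (q s t : ℂ)
    (hq0 : 0 < ‖q‖) (hq1 : ‖q‖ < 1) (hs0 : 0 < ‖s‖) (hs1 : ‖s‖ < 1)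
    (ht0 : 0 < ‖t‖) (ht1 : ‖t‖ < 1) (α : Fin (m + 1) → ℤ)
    (a : Fin (m + 1) → ℂ)
    (ha : a = interpPoint q (principalPoint s t) α) :
    -- `G_α` is the unique solution of the interpolation problem of degree `α`
    (IsInterp q (principalPoint s t) α (G q s t α) ∧
      ∀ f : LaurentPoly (m + 1),
        IsInterp q (principalPoint s t) α f →
          f = G q s t α) ∧
    -- the operators `H_j` with `1 ≤ j < n`, where `n = m + 1`
    (∀ j : Fin m,
      (simpleRefl j α = α →
        demazureLusztig t j (G q s t α) =
          t • G q s t α) ∧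
      (simpleRefl j α ≠ α →
        a j.succ - a j.castSucc ≠ 0 ∧
        demazureLusztig t j (G q s t α) =
          -G q s t α +
            ((a j.succ - t * a j.castSucc) / (a j.succ - a j.castSucc)) •
              (G q s t (simpleRefl j α) +
                G q s t α))) ∧
    -- the operator `H_n`
    (1 - a (Fin.last m) ^ 2 ≠ 0 ∧
      demazureLusztigLast m s (G q s t α) =
        -G q s t α +
          ((1 - s * a (Fin.last m)) * (1 - s⁻¹ * a (Fin.last m)) / (1 - a (Fin.last m) ^ 2)) •
            (G q s t (lastRefl m α) +
              G q s t α)) ∧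
    -- in particular, the operator `H_n` when `s_n α = α`
    (lastRefl m α = α →
      demazureLusztigLast m s (G q s t α) =
        -G q s t α) := by
  exact mainTheorem4_general m q s t (isGeneric_principalPoint (norm_pos_iff.mp hq0) hq1
    (norm_pos_iff.mp hs0) hs1 (norm_pos_iff.mp ht0) ht1) α a ha
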